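/- Let $d\ge 1$ and $A\in\mathbb{C}^{d\times d}$. Then there are constants $\Gamma,\varepsilon_0>0$ such that $$\rho(A+\varepsilon B)\ \ge\ \rho(A)-\Gamma\varepsilon$$ for all $B\in\mathbb{C}^{d\times d}$ with $\|B\|_2\le 1$ and all $\varepsilon\in(0,\varepsilon_0)$. Here $\rho(M)$ denotes the spectral radius of a matrix $M\in\mathbb{C}^{d\times d}$, i.e. the maximum of the moduli of its eigenvalues, and $\|\cdot\|_2$ is the spectral norm on $\mathbb{C}^{d\times d}$, i.e. the operator norm induced by the Euclidean norm on $\mathbb{C}^d$. -/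

import Mathlib

-- Matrices carry the operator norm induced by the Euclidean norm (the spectral norm).
open scoped Matrix.Norms.L2Operator

/-- The spectral radius of a square complex matrix as a real number: the largest modulus of
an element of its spectrum. -/
noncomputable def specRad {d : ℕ} (A : Matrix (Fin d) (Fin d) ℂ) : ℝ :=
  (spectralRadius ℂ A).toReal

/-- The spectral radius is finite, so that nothing is lost in passing to real numbers. -/
theorem ofReal_specRad {d : ℕ} (A : Matrix (Fin d) (Fin d) ℂ) :
    ENNReal.ofReal (specRad A) = spectralRadius ℂ A := by
  refine ENNReal.ofReal_toReal (ne_of_lt ?_)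
  rcases Nat.eq_zero_or_pos d with rfl | hd
  · have h : spectralRadius ℂ A = 0 := by
      simp [spectralRadius, spectrum.of_subsingleton]
    rw [h]
    exact ENNReal.zero_lt_top
  · haveI : Nonempty (Fin d) := ⟨⟨0, hd⟩⟩
    exact lt_of_le_of_lt (spectrum.spectralRadius_le_nnnorm (𝕜 := ℂ) A) ENNReal.coe_lt_top

open Polynomial

/-! Let `x` be an eigenvalue of `A` with modulus `specRad A` and algebraic multiplicity `k + 1`.
Eigenvalues near `x` may move like `ε ^ (1 / (k + 1))`, but `x` is only a simple root of the `k`-th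
derivative of the characteristic polynomial, so that derivative for `A + εB` has a root `z` within
`O(ε)` of `x`. By Gauss–Lucas, `z` lies in the convex hull of the eigenvalues of `A + εB`, hence in
the disc of radius `specRad (A + εB)`. -/

/-- If all roots of a complex polynomial lie in a convex set, so do the roots of its nonzero
iterated derivatives. -/
theorem mem_convex_of_isRoot_iterate_derivative {s : Set ℂ} (hs : Convex ℝ s) (k : ℕ)
    {p : ℂ[X]} (hp : ∀ z, p.IsRoot z → z ∈ s) (h0 : derivative^[k] p ≠ 0) {z : ℂ}
    (hz : (derivative^[k] p).IsRoot z) : z ∈ s := by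
  induction k generalizing z with
  | zero => exact hp z hz
  | succ k ih =>
    rw [Function.iterate_succ_apply'] at h0 hz
    have hk : derivative^[k] p ≠ 0 := fun h => h0 (by rw [h, derivative_zero])
    have hdeg : 0 < (derivative^[k] p).degree := by
      by_contra! h
      exact h0 (by rw [eq_C_of_degree_le_zero h, derivative_C])
    refine convexHull_min (fun w hw => ?_) hs
      (rootSet_derivative_subset_convexHull_rootSet hdeg
        (mem_rootSet.mpr ⟨h0, by simpa using hz⟩))
    exact ih hk (by simpa using (mem_rootSet.mp hw).2)

/-- A complex polynomial `p` with `p' (x) ≠ 0` has a root within distance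
`deg p * |p x| / |p' x|` of `x`. -/
theorem exists_isRoot_norm_sub_le (p : ℂ[X]) (x : ℂ) (hx : p.derivative.eval x ≠ 0) :
    ∃ z, p.IsRoot z ∧ ‖x - z‖ * ‖p.derivative.eval x‖ ≤ p.natDegree * ‖p.eval x‖ := by
  by_cases h : p.eval x = 0
  · exact ⟨x, h, by simp [h]⟩
  have hsplit : p.Splits := IsAlgClosed.splits p
  by_contra! hcon
  have hpos : 0 < ‖p.derivative.eval x‖ := norm_pos_iff.mpr hx
  have hpx : 0 < ‖p.eval x‖ := norm_pos_iff.mpr h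
  -- Logarithmic derivative: `p'/p` at `x` is the sum of `1 / (x - z)` over the roots, too small if
  -- every root is far from `x`.
  have hsum := hsplit.eval_derivative_div_eval_of_ne_zero h
  have hcard : p.roots.card = p.natDegree := hsplit.natDegree_eq_card_roots.symm
  have hne : p.roots ≠ 0 := fun h0 => by
    rw [h0] at hsum
    simp [hx, h] at hsum
  have hdeg : (0 : ℝ) < p.natDegree := by
    exact_mod_cast hcard ▸ Multiset.card_pos.mpr hne
  have hlt : ∀ z ∈ p.roots,
      ‖1 / (x - z)‖ < ‖p.derivative.eval x‖ / (p.natDegree * ‖p.eval x‖) := fun z hz => by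
    have hz' := hcon z (isRoot_of_mem_roots hz)
    have hxz : 0 < ‖x - z‖ := pos_of_mul_pos_left ((by positivity : (0 : ℝ) < _).trans hz') hpos.le
    rw [norm_div, norm_one, div_lt_div_iff₀ hxz (by positivity)]
    linarith
  have hbound := (norm_multiset_sum_le (p.roots.map fun z => 1 / (x - z))).trans_lt <| by
      rw [Multiset.map_map]
      exact Multiset.sum_lt_sum_of_nonempty hne hlt
  rw [← hsum, norm_div, Multiset.map_const', Multiset.sum_replicate, hcard, nsmul_eq_mul] at hbound
  field_simp at hbound
  exact hbound.false

/-- The value at a point of an iterated derivative of the characteristic polynomial is a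
polynomial in the entries of the matrix. -/
theorem differentiable_eval_iterate_derivative_charpoly {d : ℕ} (x : ℂ) (k : ℕ) :
    Differentiable ℂ
      fun M : Matrix (Fin d) (Fin d) ℂ => (derivative^[k] M.charpoly).eval x := by
  -- Differentiate the universal characteristic polynomial, then specialise its entries to those of
  -- `M`.
  let P := (derivative^[k] (Matrix.charpoly.univ ℂ (Fin d))).eval (MvPolynomial.C x)
  have h : (fun M : Matrix (Fin d) (Fin d) ℂ => (derivative^[k] M.charpoly).eval x) =
      fun M => MvPolynomial.aeval (fun ij : Fin d × Fin d => M ij.1 ij.2) P := by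
    funext M
    let φ := MvPolynomial.aeval (R := ℂ) fun ij : Fin d × Fin d => M ij.1 ij.2
    have hM : M.charpoly = (Matrix.charpoly.univ ℂ (Fin d)).map φ.toRingHom :=
      (Matrix.charpoly.univ_map_eval₂Hom (Fin d) (algebraMap ℂ ℂ) fun ij => M ij.1 ij.2).symm
    have hx : x = φ.toRingHom (MvPolynomial.C x) := (MvPolynomial.aeval_C _ x).symm
    change _ = φ.toRingHom P
    rw [hM, iterate_derivative_map]
    conv_lhs => rw [hx]
    exact eval_map_apply φ.toRingHom _
  rw [h]
  intro M
  refine (AnalyticAt.aeval_mvPolynomial (fun ij => ?_) P).differentiableAt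
  exact (Matrix.entryLinearMap ℂ ℂ ij.1 ij.2).toContinuousLinearMap.analyticAt M

/-- Roots of the characteristic polynomial are bounded by the spectral radius. -/
theorem norm_le_specRad {d : ℕ} {M : Matrix (Fin d) (Fin d) ℂ} {z : ℂ}
    (hz : M.charpoly.IsRoot z) : ‖z‖ ≤ specRad M := by
  have h : (‖z‖₊ : ENNReal) ≤ spectralRadius ℂ M :=
    le_iSup₂ (α := ENNReal) z (Matrix.mem_spectrum_of_isRoot_charpoly hz)
  rw [← ofReal_specRad] at h
  change ‖z‖ₑ ≤ _ at h
  rw [← ofReal_norm] at h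
  exact (ENNReal.ofReal_le_ofReal_iff ENNReal.toReal_nonneg).mp h

/-- The spectral radius is attained at a root of the characteristic polynomial. -/
theorem exists_isRoot_charpoly_norm_eq_specRad {d : ℕ} (hd : 1 ≤ d)
    (M : Matrix (Fin d) (Fin d) ℂ) : ∃ z, M.charpoly.IsRoot z ∧ ‖z‖ = specRad M := by
  have : Nonempty (Fin d) := ⟨⟨0, hd⟩⟩
  obtain ⟨z, hz, h⟩ := spectrum.exists_nnnorm_eq_spectralRadius M
  exact ⟨z, Matrix.mem_spectrum_iff_isRoot_charpoly.mp hz, by rw [specRad, ← h]; simp⟩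

theorem mainTheorem11 (d : ℕ) (hd : 1 ≤ d) (A : Matrix (Fin d) (Fin d) ℂ) :
    ∃ Γ : ℝ, 0 < Γ ∧ ∃ ε₀ : ℝ, 0 < ε₀ ∧
      ∀ B : Matrix (Fin d) (Fin d) ℂ, ‖B‖ ≤ 1 →
        ∀ ε ∈ Set.Ioo (0 : ℝ) ε₀, specRad A - Γ * ε ≤ specRad (A + (ε : ℂ) • B) := by
  obtain ⟨x, hx, hxA⟩ := exists_isRoot_charpoly_norm_eq_specRad hd A
  obtain ⟨k, hk⟩ : ∃ k, A.charpoly.rootMultiplicity x = k + 1 :=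
    Nat.exists_eq_succ_of_ne_zero
      ((rootMultiplicity_pos A.charpoly_monic.ne_zero).mpr hx).ne'
  let f (M : Matrix (Fin d) (Fin d) ℂ) : ℂ := (derivative^[k] M.charpoly).eval x
  let g (M : Matrix (Fin d) (Fin d) ℂ) : ℂ := (derivative^[k + 1] M.charpoly).eval x
  have hfA : f A = 0 := isRoot_iterate_derivative_of_lt_rootMultiplicity (by omega)
  have hgA : g A ≠ 0 := fun h => by
    have := lt_rootMultiplicity_of_isRoot_iterate_derivative A.charpoly_monic.ne_zero
      (t := x) (n := k + 1) fun m hm => by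
        rcases hm.lt_or_eq with h' | rfl
        · exact isRoot_iterate_derivative_of_lt_rootMultiplicity (by omega)
        · exact h
    omega
  obtain ⟨C, hC, hf⟩ :=
    ((differentiable_eval_iterate_derivative_charpoly (d := d) x k) A).isBigO_sub.exists_pos
  have hg : ∀ᶠ M in nhds A, ‖g A‖ / 2 < ‖g M‖ :=
    (differentiable_eval_iterate_derivative_charpoly x
      (k + 1)).continuous.norm.continuousAt.eventually_const_lt
      (half_lt_self (norm_pos_iff.mpr hgA))
  obtain ⟨δ, hδ, hball⟩ := Metric.eventually_nhds_iff.mp (hf.bound.and hg)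
  have hgpos : 0 < ‖g A‖ := norm_pos_iff.mpr hgA
  have hdpos : (0 : ℝ) < d := by exact_mod_cast hd
  -- Root-distance bound `deg * ‖f M‖ / ‖g M‖`, with `deg ≤ d`, `‖f M‖ ≤ C * ε` and `‖g M‖ > ‖g A‖ /
  -- 2`.
  refine ⟨2 * d * C / ‖g A‖, by positivity, δ, hδ, fun B hB ε hε => ?_⟩
  set M := A + (ε : ℂ) • B with hM
  have hMA : ‖M - A‖ ≤ ε := by
    rw [hM, add_sub_cancel_left, norm_smul, Complex.norm_of_nonneg hε.1.le]
    exact mul_le_of_le_one_right hε.1.le hB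
  obtain ⟨h1, h2⟩ := hball (y := M) (by rw [dist_eq_norm]; exact hMA.trans_lt hε.2)
  change ‖f M - f A‖ ≤ _ at h1
  rw [hfA, sub_zero] at h1
  have hgM : g M ≠ 0 := norm_pos_iff.mp ((half_pos hgpos).trans h2)
  have hgM' : (derivative (derivative^[k] M.charpoly)).eval x ≠ 0 := by
    rw [← Function.iterate_succ_apply' derivative k]; exact hgM
  obtain ⟨z, hz, hzx⟩ := exists_isRoot_norm_sub_le _ x hgM'
  have hz' : ‖z‖ ≤ specRad M := by
    have := mem_convex_of_isRoot_iterate_derivative (convex_closedBall (0 : ℂ) (specRad M)) k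
      (fun w hw => mem_closedBall_zero_iff.mpr (norm_le_specRad hw))
      (fun h => hgM' (by rw [h]; simp)) hz
    exact mem_closedBall_zero_iff.mp this
  rw [← Function.iterate_succ_apply' derivative k] at hzx
  have hdeg : ((derivative^[k] M.charpoly).natDegree : ℝ) ≤ d := by
    have := natDegree_iterate_derivative M.charpoly k
    rw [Matrix.charpoly_natDegree_eq_dim, Fintype.card_fin] at this
    exact_mod_cast this.trans (Nat.sub_le d k)
  have h3 : ‖x - z‖ * (‖g A‖ / 2) ≤ d * (C * ε) :=
    calc ‖x - z‖ * (‖g A‖ / 2) ≤ ‖x - z‖ * ‖g M‖ := by gcongr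
      _ ≤ _ := hzx
      _ ≤ d * (C * ε) := by
        gcongr
        exact h1.trans (by gcongr)
  have h4 : ‖x - z‖ ≤ 2 * d * C / ‖g A‖ * ε := by
    rw [div_mul_eq_mul_div, le_div_iff₀ hgpos]
    linarith
  have h5 := norm_sub_norm_le x z
  linarith
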